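/- All $\mathrm{C}^*$-algebras are unital and all $*$-homomorphisms are unit-preserving. **Definitions.** A *presentation* $A^\dagger$ of a separable $\mathrm{C}^*$-algebra $A$ is $A$ together with a sequence $(a_n)_{n\in\mathbb N}$ of elements that generates $A$ as a $\mathrm{C}^*$-algebra. Its *rational points* are the elements $p(a_{i_1},\ldots,a_{i_k})$, where $p$ is a noncommutative $*$-polynomial without constant term with coefficients in $\mathbb Q(i)$; an effective enumeration of these polynomials provides *codes* (natural numbers) for the rational points. Below, algorithms take and return codes of rational points. Let $A^\dagger$ and $B^\#$ be presentations of $A$ and $B$. - $A^\dagger$ is *computable* if there is an algorithm which, given a rational point $p$ and $k\in\mathbb N$, returns a rational number $q$ with $|\|p\|-q|<2^{-k}$. - $x\in A$ is a *computable point* of $A^\dagger$ if there is an algorithm which, given $k\in\mathbb N$, returns a rational point $q$ of $A^\dagger$ with $\|x-q\|<2^{-k}$; a code of such an algorithm is called a code of $x$. A sequence $(x_n)$ of computable points is a *computable sequence* in $A^\dagger$ if there is an algorithm which, given $n$, returns a code of $x_n$. - A function $\varphi:A\to B$ is a *computable map* $A^\dagger\to B^\#$ if there is an algorithm which, given a rational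 point $p$ of $A^\dagger$ and $k\in\mathbb N$, returns a rational point $q$ of $B^\#$ with $\|\varphi(p)-q\|<2^{-k}$. A *computable isomorphism* is a $*$-isomorphism that is a computable map with computable inverse. - Two computable $*$-homomorphisms $\varphi,\psi:A^\dagger\to B^\#$ are *computably approximately unitarily equivalent* if there are a computable sequence $(v_n)_{n\in\mathbb N}$ in $B^\#$ consisting of unitaries and an algorithm which, given a rational point $a$ of $A^\dagger$ and $m\in\mathbb N$, returns $n\in\mathbb N$ with $\|v_n\varphi(a)v_n^*-\psi(a)\|<2^{-m}$. **Theorem** (computable approximate intertwining). Let $A$ and $B$ be separable, unital $\mathrm{C}^*$-algebras and let $\varphi:A\to B$ be an injective $*$-homomorphism. Equip $A$ and $B$ with computable presentations $A^\dagger$ and $B^\#$ respectively. Suppose the following conditions hold: 1. $1$ is a computable point of $B^\#$. 2. $\varphi:A^\dagger\to B^\#$ is a computable map. 3. There is a sequence of unitaries $(w_n)_{n\in\mathbb N}$ from $B$ such that $$\lim_{n\to\infty}\|w_n\varphi(a)-\varphi(a)w_n\|=0\quad\text{and}\quad\lim_{n\to\infty}d(w_n^*bw_n,\varphi(A))=0$$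 for all $a\in A$ and $b\in B$. Then there is a computable isomorphism $\psi:A^\dagger\to B^\#$ that is computably approximately unitarily equivalent to $\varphi$. -/

import Mathlib

open Filter Topology

/-- A letter of a `*`-word: `(i, false)` stands for the indeterminate `x_i` and
`(i, true)` for its adjoint `x_i^*`. -/
abbrev StarLetter : Type := ℕ × Bool

/-- A rational `*`-monomial without constant term: the coefficient `(x, y, d)` stands for
the Gaussian rational `(x + y i) / (d + 1)`, and the nonempty word is given by its first
letter and the list of its remaining letters. -/
abbrev RatMonomial : Type := (ℤ × ℤ × ℕ) × StarLetter × List StarLetter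

/-- Rational `*`-polynomials, that is noncommutative `*`-polynomials without constant term
with coefficients in `ℚ(i)`, written as formal sums of monomials. This type carries
Mathlib's standard effective coding by natural numbers (its `Primcodable` structure), which
provides the codes of the rational points of a presentation. -/
abbrev RatPoly : Type := List RatMonomial

/-- The Gaussian rational `(x + y i) / (d + 1)`. -/
noncomputable def gaussRat (c : ℤ × ℤ × ℕ) : ℂ :=
  ((c.1 : ℂ) + (c.2.1 : ℂ) * Complex.I) / ((c.2.2 : ℂ) + 1)

/-- The rational number `x / (d + 1)`; every rational number is of this form. -/
def codedRat (c : ℤ × ℕ) : ℚ := (c.1 : ℚ) / ((c.2 : ℚ) + 1)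

/-- A presentation of a (unital) C*-algebra `A`: a sequence of special points of `A` that
generates `A` as a C*-algebra. The unit is not automatically adjoined. -/
structure Presentation (A : Type*) [CStarAlgebra A] where
  special : ℕ → A
  generates :
    (NonUnitalStarAlgebra.adjoin ℂ (Set.range special)).topologicalClosure = ⊤

namespace Presentation

variable {A : Type*} [CStarAlgebra A] {B : Type*} [CStarAlgebra B]

/-- The value of a letter at the special points. -/
def evalLetter (P : Presentation A) (l : StarLetter) : A :=
  if l.2 then star (P.special l.1) else P.special l.1

/-- The value of a monomial at the special points. -/
noncomputable def evalMonomial (P : Presentation A) (m : RatMonomial) : A :=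
  gaussRat m.1 • (P.evalLetter m.2.1 * (m.2.2.map P.evalLetter).prod)

/-- The rational point of the presentation with code `p`: the value of the rational
`*`-polynomial `p` at the special points. -/
noncomputable def point (P : Presentation A) (p : RatPoly) : A :=
  (p.map P.evalMonomial).sum

/-- The presentation is computable: from (a code of) a rational point and `k` one can compute
a rational number within `2^{-k}` of the norm of the point. -/
def IsComputable (P : Presentation A) : Prop :=
  ∃ f : RatPoly × ℕ → ℤ × ℕ, Computable f ∧
    ∀ (p : RatPoly) (k : ℕ), |‖P.point p‖ - (codedRat (f (p, k)) : ℝ)| < ((2 : ℝ) ^ k)⁻¹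

/-- The program `c` is a code of `x` as a computable point: on every input `k` it halts and
returns the code of a rational point at distance less than `2^{-k}` from `x`. -/
def IsPointCode (P : Presentation A) (c : Nat.Partrec.Code) (x : A) : Prop :=
  ∀ k : ℕ, ∃ p : RatPoly, Encodable.encode p ∈ c.eval k ∧ ‖x - P.point p‖ < ((2 : ℝ) ^ k)⁻¹

/-- `x` is a computable point of the presentation. -/
def IsComputablePoint (P : Presentation A) (x : A) : Prop :=
  ∃ c : Nat.Partrec.Code, P.IsPointCode c x

/-- `x` is a computable sequence of the presentation: from `n` one can compute a code of
`x n` as a computable point. -/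
def IsComputableSeq (P : Presentation A) (x : ℕ → A) : Prop :=
  ∃ c : ℕ → Nat.Partrec.Code, Computable c ∧ ∀ n : ℕ, P.IsPointCode (c n) (x n)

/-- `φ` is a computable map from the presentation `P` to the presentation `Q`: from a rational
point `p` of `P` and `k` one can compute a rational point of `Q` within `2^{-k}` of `φ p`. -/
def IsComputableMap (P : Presentation A) (Q : Presentation B) (φ : A → B) : Prop :=
  ∃ f : RatPoly × ℕ → RatPoly, Computable f ∧
    ∀ (p : RatPoly) (k : ℕ), ‖φ (P.point p) - Q.point (f (p, k))‖ < ((2 : ℝ) ^ k)⁻¹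

/-- A `*`-isomorphism that is a computable map with computable inverse. -/
def IsComputableIso (P : Presentation A) (Q : Presentation B) (ψ : A ≃⋆ₐ[ℂ] B) : Prop :=
  IsComputableMap P Q ψ ∧ IsComputableMap Q P ψ.symm

/-- Two computable `*`-homomorphisms are computably approximately unitarily equivalent:
there is a computable sequence `v` of unitaries of `B` such that from a rational point `a` of
`P` and `m` one can compute `n` with `‖v_n φ(a) v_n^* - ψ(a)‖ < 2^{-m}`. -/
def CompApproxUnitarilyEquiv (P : Presentation A) (Q : Presentation B)
    (φ ψ : A →⋆ₐ[ℂ] B) : Prop :=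
  IsComputableMap P Q φ ∧ IsComputableMap P Q ψ ∧
    ∃ v : ℕ → B, Q.IsComputableSeq v ∧ (∀ n : ℕ, v n ∈ unitary B) ∧
      ∃ g : RatPoly × ℕ → ℕ, Computable g ∧ ∀ (p : RatPoly) (m : ℕ),
        ‖v (g (p, m)) * φ (P.point p) * star (v (g (p, m))) - ψ (P.point p)‖
          < ((2 : ℝ) ^ m)⁻¹

end Presentation

/-!
The proof is an approximate intertwining in which every choice is found by a search.

Unitaries `u_n` of `B` are built so that the `*`-homomorphisms `θ_n = u_n φ(·) u_n^*` converge
pointwise. At stage `n` a finite list of rational points of `A` is under control, and `u_{n+1}` and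
a rational point `c_n` of `A` are chosen such that `θ_{n+1}` and `θ_n` differ by less than `2^{-n}`
on the list and `θ_{n+1}(c_n)` is within `2^{-n}` of a prescribed rational point of `B`; then `c_n`
and the next point of an enumeration of the rational points of `A` join the list. Such a choice
exists: `u_n w_N` works for large `N` by the hypothesis on the `w_N`, and the requirements are open
(`exists_stageSpec`). The limit `ψ` of the `θ_n` is isometric, as `φ` is, and at a point that is on
the list at stage `n` it differs from `θ_n` by at most `2 · 2^{-n}`. Each rational point of `B` is
prescribed infinitely often, so the points `c_n` make the range of `ψ` dense, hence everything, and
they compute `ψ⁻¹`; the `θ_n` compute `ψ` (`IsSearchRun.exists_limit`,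
`IsSearchRun.norm_limit_chosen_sub_le`).

For the construction to be effective, `u_n` is encoded by a rational point `r` for which `r^* r` and
`r r^*` are close to `1`, and `u_n` is the unitary factor of the polar decomposition of `r`. It is
the limit of the Newton–Schulz iteration `x ↦ (3 x - x x^* x) / 2`, which involves only
`*`-polynomials without constant term over `ℚ` and so takes rational points to rational points, and
which converges at a known rate (`norm_unitaryPart_sub_iterate_lt`). All requirements on
`(r, c_n)` are strict upper bounds on norms of elements that are uniformly computable on the set of
admissible data, so they are semidecidable there (`ComputableOn.semiDecidableOn_norm_lt`,
`semiDecidableOn_stageSpec`), and an unbounded search finds a valid choice at each stage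
(`exists_computable_run`). The unit of `B` enters only in testing that `r` is admissible.
-/

/-! ### Primitive recursive arithmetic of integers and Gaussian rationals -/

/-- The coding of `ℤ` sends `n` to `2 n` and `-(n + 1)` to `2 n + 1`. -/
theorem Primrec.int_ofNat : Primrec (fun n : ℕ => (n : ℤ)) :=
  Primrec.encode_iff.1 <| Primrec.nat_double.of_eq fun _ => rfl

theorem Primrec.int_negSucc : Primrec Int.negSucc :=
  Primrec.encode_iff.1 <| Primrec.nat_double_succ.of_eq fun _ => rfl

theorem Primrec.int_toNat : Primrec Int.toNat := by
  refine (Primrec.cond (Primrec.nat_bodd.comp Primrec.encode) (Primrec.const 0)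
    (Primrec.nat_div2.comp Primrec.encode)).of_eq fun z => ?_
  cases z with
  | ofNat n =>
    have h : Encodable.encode (Int.ofNat n) = 2 * n := rfl
    rw [h]
    simp [Nat.div2_val]
  | negSucc n =>
    have h : Encodable.encode (Int.negSucc n) = 2 * n + 1 := rfl
    simp [h]

theorem Primrec.int_toNat_neg : Primrec (fun z : ℤ => (-z).toNat) := by
  refine (Primrec.cond (Primrec.nat_bodd.comp Primrec.encode)
    (Primrec.succ.comp (Primrec.nat_div2.comp Primrec.encode)) (Primrec.const 0)).of_eq fun z => ?_
  cases z with
  | ofNat n =>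
    have h : Encodable.encode (Int.ofNat n) = 2 * n := rfl
    rw [h]
    simp
  | negSucc n =>
    have h : Encodable.encode (Int.negSucc n) = 2 * n + 1 := rfl
    simp [h, Nat.div2_val, Int.neg_negSucc]

theorem Primrec.int_subNatNat : Primrec₂ Int.subNatNat := by
  refine (Primrec.ite (Primrec.nat_le.comp Primrec.snd Primrec.fst)
    (Primrec.int_ofNat.comp (Primrec.nat_sub.comp Primrec.fst Primrec.snd))
    (Primrec.int_negSucc.comp (Primrec.pred.comp
      (Primrec.nat_sub.comp Primrec.snd Primrec.fst)))).of_eq fun p => ?_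
  rw [Int.subNatNat_eq_coe]
  split_ifs with h
  · omega
  · rw [Int.negSucc_eq]
    simp only [Nat.pred_eq_sub_one]
    omega

theorem Primrec.int_add : Primrec₂ ((· + ·) : ℤ → ℤ → ℤ) := by
  refine (Primrec.int_subNatNat.comp
    (Primrec.nat_add.comp (Primrec.int_toNat.comp Primrec.fst) (Primrec.int_toNat.comp Primrec.snd))
    (Primrec.nat_add.comp (Primrec.int_toNat_neg.comp Primrec.fst)
      (Primrec.int_toNat_neg.comp Primrec.snd))).of_eq fun p => ?_
  rw [Int.subNatNat_eq_coe]
  beta_reduce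
  omega

theorem Primrec.int_neg : Primrec (fun z : ℤ => -z) := by
  refine (Primrec.int_subNatNat.comp Primrec.int_toNat_neg Primrec.int_toNat).of_eq fun p => ?_
  rw [Int.subNatNat_eq_coe]
  omega

theorem Primrec.int_sub : Primrec₂ ((· - ·) : ℤ → ℤ → ℤ) :=
  (Primrec.int_add.comp Primrec.fst (Primrec.int_neg.comp Primrec.snd)).of_eq
    fun p => (sub_eq_add_neg p.1 p.2).symm

theorem Primrec.int_mul : Primrec₂ ((· * ·) : ℤ → ℤ → ℤ) := by
  have m (f g : ℤ → ℕ) (hf : Primrec f) (hg : Primrec g) :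
      Primrec fun p : ℤ × ℤ => f p.1 * g p.2 :=
    Primrec.nat_mul.comp (hf.comp Primrec.fst) (hg.comp Primrec.snd)
  refine (Primrec.int_subNatNat.comp
    (Primrec.nat_add.comp (m _ _ Primrec.int_toNat Primrec.int_toNat)
      (m _ _ Primrec.int_toNat_neg Primrec.int_toNat_neg))
    (Primrec.nat_add.comp (m _ _ Primrec.int_toNat Primrec.int_toNat_neg)
      (m _ _ Primrec.int_toNat_neg Primrec.int_toNat))).of_eq fun p => ?_
  rw [Int.subNatNat_eq_coe]
  have h (z : ℤ) : z = z.toNat - (-z).toNat := by omega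
  conv_rhs => rw [h p.1, h p.2]
  push_cast
  ring

theorem Primrec.nat_pow_two : Primrec (fun n : ℕ => 2 ^ n) :=
  (Primrec₂.unpaired'.1 Nat.Primrec.pow).comp (Primrec.const 2) Primrec.id

/-- Multiplication of coded Gaussian rationals. -/
def gaussMul (c d : ℤ × ℤ × ℕ) : ℤ × ℤ × ℕ :=
  (c.1 * d.1 - c.2.1 * d.2.1, c.1 * d.2.1 + c.2.1 * d.1, c.2.2 * d.2.2 + (c.2.2 + d.2.2))

theorem gaussRat_gaussMul (c d : ℤ × ℤ × ℕ) :
    gaussRat (gaussMul c d) = gaussRat c * gaussRat d := by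
  have hc : (c.2.2 : ℂ) + 1 ≠ 0 := Nat.cast_add_one_ne_zero _
  have hd : (d.2.2 : ℂ) + 1 ≠ 0 := Nat.cast_add_one_ne_zero _
  simp only [gaussRat, gaussMul]
  rw [div_mul_div_comm]
  congr 1
  · push_cast
    linear_combination (-(c.2.1 : ℂ) * d.2.1) * Complex.I_mul_I
  · push_cast
    ring

theorem primrec_gaussMul : Primrec₂ gaussMul := by
  have c1 : Primrec fun p : (ℤ × ℤ × ℕ) × (ℤ × ℤ × ℕ) => p.1.1 := Primrec.fst.comp Primrec.fst
  have c2 : Primrec fun p : (ℤ × ℤ × ℕ) × (ℤ × ℤ × ℕ) => p.1.2.1 :=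
    Primrec.fst.comp (Primrec.snd.comp Primrec.fst)
  have c3 : Primrec fun p : (ℤ × ℤ × ℕ) × (ℤ × ℤ × ℕ) => p.1.2.2 :=
    Primrec.snd.comp (Primrec.snd.comp Primrec.fst)
  have d1 : Primrec fun p : (ℤ × ℤ × ℕ) × (ℤ × ℤ × ℕ) => p.2.1 := Primrec.fst.comp Primrec.snd
  have d2 : Primrec fun p : (ℤ × ℤ × ℕ) × (ℤ × ℤ × ℕ) => p.2.2.1 :=
    Primrec.fst.comp (Primrec.snd.comp Primrec.snd)
  have d3 : Primrec fun p : (ℤ × ℤ × ℕ) × (ℤ × ℤ × ℕ) => p.2.2.2 :=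
    Primrec.snd.comp (Primrec.snd.comp Primrec.snd)
  exact Primrec.pair
    (Primrec.int_sub.comp (Primrec.int_mul.comp c1 d1) (Primrec.int_mul.comp c2 d2))
    (Primrec.pair
      (Primrec.int_add.comp (Primrec.int_mul.comp c1 d2) (Primrec.int_mul.comp c2 d1))
      (Primrec.nat_add.comp (Primrec.nat_mul.comp c3 d3) (Primrec.nat_add.comp c3 d3)))

theorem denseRange_gaussRat : DenseRange gaussRat := by
  refine Metric.denseRange_iff.2 fun z r hr => ?_
  obtain ⟨n, hn⟩ := exists_nat_one_div_lt (half_pos hr)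
  have hn0 : (0 : ℝ) < (n : ℝ) + 1 := by positivity
  have key (t : ℝ) : |t - ⌊t * (n + 1)⌋ / (n + 1)| < r / 2 := by
    have h1 := Int.floor_le (t * (n + 1))
    have h2 := Int.lt_floor_add_one (t * (n + 1))
    refine lt_of_le_of_lt ?_ hn
    have : t - ⌊t * (n + 1)⌋ / (n + 1) = (t * (n + 1) - ⌊t * (n + 1)⌋) / (n + 1) := by field_simp
    rw [this, abs_div, abs_of_pos hn0, abs_of_nonneg (by linarith)]
    gcongr
    linarith
  refine ⟨(⌊z.re * (n + 1)⌋, ⌊z.im * (n + 1)⌋, n), ?_⟩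
  have hg : gaussRat (⌊z.re * (n + 1)⌋, ⌊z.im * (n + 1)⌋, n) =
      ((⌊z.re * (n + 1)⌋ / (n + 1) : ℝ) : ℂ) +
        ((⌊z.im * (n + 1)⌋ / (n + 1) : ℝ) : ℂ) * Complex.I := by
    simp only [gaussRat]
    push_cast
    ring
  rw [dist_eq_norm, hg]
  refine (Complex.norm_le_abs_re_add_abs_im _).trans_lt ?_
  have h1 := key z.re
  have h2 := key z.im
  simp only [Complex.sub_re, Complex.sub_im, Complex.add_re, Complex.add_im, Complex.ofReal_re,
    Complex.ofReal_im, Complex.re_ofReal_mul, Complex.im_ofReal_mul, Complex.I_re, Complex.I_im,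
    mul_zero, mul_one, add_zero, zero_add]
  linarith

/-! ### The `*`-algebra operations on coded polynomials -/

/-- The adjoint of a letter. -/
def StarLetter.adj (l : StarLetter) : StarLetter := (l.1, !l.2)

/-- The product of two coded monomials. -/
def RatMonomial.mul (m n : RatMonomial) : RatMonomial :=
  (gaussMul m.1 n.1, m.2.1, m.2.2 ++ n.2.1 :: n.2.2)

/-- The adjoint of a coded monomial. The adjoint word is the reversal of a nonempty word, so the
default value of `headI` is never used. -/
def RatMonomial.adj (m : RatMonomial) : RatMonomial :=
  ((m.1.1, -m.1.2.1, m.1.2.2),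
    (((m.2.1 :: m.2.2).map StarLetter.adj).reverse.headI,
      ((m.2.1 :: m.2.2).map StarLetter.adj).reverse.tail))

/-- The product of two coded polynomials. -/
def RatPoly.mul (p q : RatPoly) : RatPoly := p.flatMap fun m => q.map fun n => RatMonomial.mul m n

/-- The adjoint of a coded polynomial. -/
def RatPoly.adj (p : RatPoly) : RatPoly := p.map RatMonomial.adj

/-- The multiple of a coded polynomial by a coded Gaussian rational. -/
def RatPoly.smul (c : ℤ × ℤ × ℕ) (p : RatPoly) : RatPoly := p.map fun m => (gaussMul c m.1, m.2)

theorem primrec_ratPoly_mul : Primrec₂ RatPoly.mul := by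
  have hm : Primrec₂ RatMonomial.mul := by
    have w : Primrec fun p : RatMonomial × RatMonomial => p.2.2.1 :: p.2.2.2 :=
      Primrec.list_cons.comp (Primrec.fst.comp (Primrec.snd.comp Primrec.snd))
        (Primrec.snd.comp (Primrec.snd.comp Primrec.snd))
    exact Primrec.pair
      (primrec_gaussMul.comp (Primrec.fst.comp Primrec.fst) (Primrec.fst.comp Primrec.snd))
      (Primrec.pair (Primrec.fst.comp (Primrec.snd.comp Primrec.fst))
        (Primrec.list_append.comp (Primrec.snd.comp (Primrec.snd.comp Primrec.fst)) w))
  exact Primrec.list_flatMap Primrec.fst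
    (Primrec.list_map (Primrec.snd.comp Primrec.fst)
      (hm.comp (Primrec.snd.comp Primrec.fst) Primrec.snd))

theorem primrec_ratPoly_adj : Primrec RatPoly.adj := by
  have hl : Primrec StarLetter.adj :=
    Primrec.pair Primrec.fst (Primrec.not.comp Primrec.snd)
  have w : Primrec fun m : RatMonomial => ((m.2.1 :: m.2.2).map StarLetter.adj).reverse :=
    Primrec.list_reverse.comp (Primrec.list_map
      (Primrec.list_cons.comp (Primrec.fst.comp Primrec.snd) (Primrec.snd.comp Primrec.snd))
      (hl.comp Primrec.snd))
  have hm : Primrec RatMonomial.adj :=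
    Primrec.pair
      (Primrec.pair (Primrec.fst.comp Primrec.fst)
        (Primrec.pair (Primrec.int_neg.comp (Primrec.fst.comp (Primrec.snd.comp Primrec.fst)))
          (Primrec.snd.comp (Primrec.snd.comp Primrec.fst))))
      (Primrec.pair (Primrec.list_headI.comp w) (Primrec.list_tail.comp w))
  exact Primrec.list_map Primrec.id (hm.comp Primrec.snd)

theorem primrec_ratPoly_smul (c : ℤ × ℤ × ℕ) : Primrec (RatPoly.smul c) :=
  Primrec.list_map Primrec.id
    (Primrec.pair (primrec_gaussMul.comp (Primrec.const c) (Primrec.fst.comp Primrec.snd))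
      (Primrec.snd.comp Primrec.snd))

namespace Presentation

variable {A : Type*} [CStarAlgebra A] (P : Presentation A)

theorem point_nil : P.point [] = 0 := by simp [point]

theorem point_cons (m : RatMonomial) (p : RatPoly) :
    P.point (m :: p) = P.evalMonomial m + P.point p := by simp [point]

theorem point_append (p q : RatPoly) : P.point (p ++ q) = P.point p + P.point q := by
  simp [point]

theorem point_smul (c : ℤ × ℤ × ℕ) (p : RatPoly) :
    P.point (RatPoly.smul c p) = gaussRat c • P.point p := by
  induction p with
  | nil => simp [RatPoly.smul, point]
  | cons m p ih =>
    rw [RatPoly.smul] at ih ⊢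
    rw [List.map_cons, point_cons, ih, point_cons, smul_add]
    simp [evalMonomial, gaussRat_gaussMul, mul_smul]

theorem point_mul (p q : RatPoly) : P.point (RatPoly.mul p q) = P.point p * P.point q := by
  have mono (m : RatMonomial) (q : RatPoly) :
      P.point (q.map fun n => RatMonomial.mul m n) = P.evalMonomial m * P.point q := by
    induction q with
    | nil => simp [point]
    | cons n q ih =>
      rw [List.map_cons, point_cons, ih, point_cons, mul_add]
      congr 1
      simp only [evalMonomial, RatMonomial.mul, gaussRat_gaussMul, List.map_append, List.map_cons,
        List.prod_append, List.prod_cons, smul_mul_smul_comm, mul_assoc]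
  induction p with
  | nil => simp [RatPoly.mul, point]
  | cons m p ih =>
    rw [RatPoly.mul] at ih ⊢
    rw [List.flatMap_cons, point_append, mono, ih, point_cons, add_mul]

theorem point_adj (p : RatPoly) : P.point (RatPoly.adj p) = star (P.point p) := by
  have letter (l : StarLetter) : P.evalLetter l.adj = star (P.evalLetter l) := by
    rcases l with ⟨i, _ | _⟩ <;> simp [evalLetter, StarLetter.adj]
  have word (w : List StarLetter) :
      ((w.map StarLetter.adj).reverse.map P.evalLetter).prod = star (w.map P.evalLetter).prod := by
    induction w with
    | nil => simp
    | cons l w ih =>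
      rw [List.map_cons, List.reverse_cons, List.map_append, List.prod_append, ih]
      simp [letter]
  have split (w : List StarLetter) (hw : w ≠ []) :
      P.evalLetter w.headI * (w.tail.map P.evalLetter).prod = (w.map P.evalLetter).prod := by
    cases w with
    | nil => exact absurd rfl hw
    | cons l w => simp
  induction p with
  | nil => simp [RatPoly.adj, point]
  | cons m p ih =>
    rw [RatPoly.adj] at ih ⊢
    rw [List.map_cons, point_cons, ih, point_cons, star_add]
    congr 1
    have hs : star (gaussRat m.1) = gaussRat (m.1.1, -m.1.2.1, m.1.2.2) := by
      simp [gaussRat]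
    rw [evalMonomial, evalMonomial, star_smul, hs]
    simp only [RatMonomial.adj]
    rw [split _ (by simp), word, List.map_cons, List.prod_cons]

theorem denseRange_point : DenseRange P.point := by
  have hadd : ∀ x ∈ closure (Set.range P.point), ∀ y ∈ closure (Set.range P.point),
      x + y ∈ closure (Set.range P.point) := fun x hx y hy =>
    map_mem_closure₂ continuous_add hx hy (by
      rintro _ ⟨p, rfl⟩ _ ⟨q, rfl⟩; exact ⟨p ++ q, P.point_append p q⟩)
  have hsub : (NonUnitalStarAlgebra.adjoin ℂ (Set.range P.special) : Set A) ⊆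
      closure (Set.range P.point) := by
    intro x hx
    induction hx using NonUnitalStarAlgebra.adjoin_induction with
    | mem x hx =>
      obtain ⟨i, rfl⟩ := hx
      exact subset_closure ⟨[((1, 0, 0), ((i, false), []))],
        by simp [point, evalMonomial, gaussRat, evalLetter]⟩
    | zero => exact subset_closure ⟨[], P.point_nil⟩
    | add x y _ _ hx hy => exact hadd x hx y hy
    | mul x y _ _ hx hy =>
      exact map_mem_closure₂ continuous_mul hx hy (by
        rintro _ ⟨p, rfl⟩ _ ⟨q, rfl⟩; exact ⟨RatPoly.mul p q, P.point_mul p q⟩)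
    | smul c x _ hx =>
      exact map_mem_closure₂ continuous_smul (denseRange_gaussRat c) hx (by
        rintro _ ⟨c, rfl⟩ _ ⟨p, rfl⟩; exact ⟨RatPoly.smul c p, P.point_smul c p⟩)
    | star x _ hx =>
      exact map_mem_closure continuous_star hx (by
        rintro _ ⟨p, rfl⟩; exact ⟨RatPoly.adj p, P.point_adj p⟩)
  intro x
  have hx : x ∈ (NonUnitalStarAlgebra.adjoin ℂ (Set.range P.special)).topologicalClosure := by
    rw [P.generates]; trivial
  exact closure_minimal hsub isClosed_closure hx

end Presentation

/-! ### The unitary part of an almost unitary element -/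

section NewtonSchulz

variable {B : Type*} [CStarAlgebra B]

/-- One step of the Newton–Schulz iteration for the unitary part of an element. -/
noncomputable def newtonSchulz (x : B) : B := (3 / 2 : ℂ) • x + (-1 / 2 : ℂ) • (x * star x * x)

/-- The elements `x` for which `x^* x` and `x x^*` are at distance less than `1 / 2` from `1`. -/
def almostUnitary (B : Type*) [CStarAlgebra B] : Set B :=
  {x | ‖star x * x - 1‖ < 2⁻¹ ∧ ‖x * star x - 1‖ < 2⁻¹}

/-- The limit of the Newton–Schulz iteration. For an almost unitary element this is a unitary,
the unitary factor of the polar decomposition; no meaning is attached to it elsewhere. -/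
noncomputable def unitaryPart (x : B) : B := limUnder atTop fun n : ℕ => newtonSchulz^[n] x

theorem CStarAlgebra.norm_one_le : ‖(1 : B)‖ ≤ 1 := by
  rcases subsingleton_or_nontrivial B with h | h
  · rw [Subsingleton.elim (1 : B) 0, norm_zero]
    exact zero_le_one
  · exact CStarRing.norm_one.le

theorem newtonSchulz_star (x : B) : newtonSchulz (star x) = star (newtonSchulz x) := by
  simp [newtonSchulz, mul_assoc]

theorem iterate_newtonSchulz_star (x : B) (n : ℕ) :
    newtonSchulz^[n] (star x) = star (newtonSchulz^[n] x) := by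
  induction n with
  | zero => rfl
  | succ n ih => rw [Function.iterate_succ_apply', Function.iterate_succ_apply', ih,
      newtonSchulz_star]

/-- The defect `e = 1 - x^* x` is replaced by `(3/4) e² + (1/4) e³`, so it decreases
quadratically. -/
theorem one_sub_star_mul_newtonSchulz (x : B) :
    1 - star (newtonSchulz x) * newtonSchulz x =
      (3 / 4 : ℂ) • ((1 - star x * x) * (1 - star x * x)) +
        (1 / 4 : ℂ) • ((1 - star x * x) * (1 - star x * x) * (1 - star x * x)) := by
  simp only [newtonSchulz, star_add, star_smul, star_mul, star_star, mul_add, add_mul, mul_sub,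
    sub_mul, smul_mul_assoc, mul_smul_comm, mul_assoc, one_mul, mul_one, smul_add, smul_sub]
  simp only [Complex.star_def, map_div₀, map_neg, map_ofNat, map_one]
  module

theorem norm_one_sub_newtonSchulz_le {x : B} (hx : ‖1 - star x * x‖ ≤ 1 / 2) :
    ‖1 - star (newtonSchulz x) * newtonSchulz x‖ ≤ ‖1 - star x * x‖ / 2 := by
  rw [one_sub_star_mul_newtonSchulz]
  set e := 1 - star x * x
  have h2 : ‖e * e‖ ≤ ‖e‖ * (1 / 2) :=
    (norm_mul_le _ _).trans (mul_le_mul_of_nonneg_left hx (norm_nonneg e))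
  have h3 : ‖e * e * e‖ ≤ ‖e‖ * (1 / 2) * (1 / 2) :=
    (norm_mul_le _ _).trans (mul_le_mul h2 hx (norm_nonneg e) (by positivity))
  refine (norm_add_le _ _).trans ?_
  rw [norm_smul, norm_smul]
  norm_num
  linarith [norm_nonneg e]

theorem norm_newtonSchulz_sub_le {x : B} (hx : ‖1 - star x * x‖ ≤ 1 / 2) :
    ‖newtonSchulz x - x‖ ≤ ‖1 - star x * x‖ := by
  have h : newtonSchulz x - x = (1 / 2 : ℂ) • (x * (1 - star x * x)) := by
    simp only [newtonSchulz, mul_sub, mul_one, mul_assoc]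
    module
  have hx2 : ‖x‖ ≤ 2 := by
    have h1 : ‖star x * x‖ ≤ 1 + 1 / 2 := by
      calc ‖star x * x‖ = ‖1 - (1 - star x * x)‖ := by rw [sub_sub_cancel]
        _ ≤ ‖(1 : B)‖ + ‖1 - star x * x‖ := norm_sub_le _ _
        _ ≤ 1 + 1 / 2 := add_le_add CStarAlgebra.norm_one_le hx
    rw [CStarRing.norm_star_mul_self] at h1
    nlinarith [norm_nonneg x]
  rw [h, norm_smul]
  have := norm_mul_le x (1 - star x * x)
  norm_num
  nlinarith [norm_nonneg (1 - star x * x)]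

theorem norm_one_sub_iterate_newtonSchulz_le {x : B} (hx : ‖1 - star x * x‖ ≤ 1 / 2) (n : ℕ) :
    ‖1 - star (newtonSchulz^[n] x) * newtonSchulz^[n] x‖ ≤ ‖1 - star x * x‖ * (1 / 2) ^ n := by
  induction n with
  | zero => simp
  | succ n ih =>
    rw [Function.iterate_succ_apply']
    have h : (1 / 2 : ℝ) ^ n ≤ 1 := pow_le_one₀ (by norm_num) (by norm_num)
    refine (norm_one_sub_newtonSchulz_le ?_).trans ?_
    · nlinarith [norm_nonneg (1 - star x * x)]
    · rw [pow_succ]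
      linarith

theorem dist_iterate_newtonSchulz_le {x : B} (hx : ‖1 - star x * x‖ ≤ 1 / 2) (n : ℕ) :
    dist (newtonSchulz^[n] x) (newtonSchulz^[n + 1] x) ≤ ‖1 - star x * x‖ * (1 / 2) ^ n := by
  have h : (1 / 2 : ℝ) ^ n ≤ 1 := pow_le_one₀ (by norm_num) (by norm_num)
  have h' := norm_one_sub_iterate_newtonSchulz_le hx n
  rw [Function.iterate_succ_apply', dist_comm, dist_eq_norm]
  refine (norm_newtonSchulz_sub_le ?_).trans h'
  nlinarith [norm_nonneg (1 - star x * x)]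

theorem tendsto_iterate_newtonSchulz {x : B} (hx : ‖1 - star x * x‖ ≤ 1 / 2) :
    Tendsto (fun n => newtonSchulz^[n] x) atTop (𝓝 (unitaryPart x)) :=
  (cauchySeq_of_le_geometric _ _ (by norm_num) (dist_iterate_newtonSchulz_le hx)).tendsto_limUnder

theorem norm_unitaryPart_sub_iterate_le {x : B} (hx : ‖1 - star x * x‖ ≤ 1 / 2) (n : ℕ) :
    ‖unitaryPart x - newtonSchulz^[n] x‖ ≤ 2 * ‖1 - star x * x‖ * (1 / 2) ^ n := by
  have := dist_le_of_le_geometric_of_tendsto (1 / 2) _ (by norm_num)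
    (dist_iterate_newtonSchulz_le hx) (tendsto_iterate_newtonSchulz hx) n
  rw [dist_comm, dist_eq_norm] at this
  refine this.trans (le_of_eq ?_)
  ring

theorem tendsto_star_mul_iterate_newtonSchulz {x : B} (hx : ‖1 - star x * x‖ ≤ 1 / 2) :
    Tendsto (fun n => star (newtonSchulz^[n] x) * newtonSchulz^[n] x) atTop (𝓝 1) := by
  refine tendsto_iff_norm_sub_tendsto_zero.2 (squeeze_zero (fun _ => norm_nonneg _)
    (fun n => (norm_sub_rev _ _).trans_le (norm_one_sub_iterate_newtonSchulz_le hx n)) ?_)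
  simpa using (tendsto_pow_atTop_nhds_zero_of_lt_one (by norm_num : (0 : ℝ) ≤ 1 / 2)
    (by norm_num)).const_mul ‖1 - star x * x‖

theorem almostUnitary_defect {x : B} (hx : x ∈ almostUnitary B) :
    ‖1 - star x * x‖ ≤ 1 / 2 ∧ ‖1 - star (star x) * star x‖ ≤ 1 / 2 := by
  rw [norm_sub_rev, norm_sub_rev (1 : B), star_star]
  exact ⟨by linarith [hx.1], by linarith [hx.2]⟩

theorem unitaryPart_mem_unitary {x : B} (hx : x ∈ almostUnitary B) :
    unitaryPart x ∈ unitary B := by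
  obtain ⟨h1, h2⟩ := almostUnitary_defect hx
  have t := tendsto_iterate_newtonSchulz h1
  refine Unitary.mem_iff.2 ⟨tendsto_nhds_unique (t.star.mul t)
    (tendsto_star_mul_iterate_newtonSchulz h1), tendsto_nhds_unique (t.mul t.star) ?_⟩
  have h := tendsto_star_mul_iterate_newtonSchulz h2
  simpa only [iterate_newtonSchulz_star, star_star] using h

theorem norm_unitaryPart_sub_iterate_lt {x : B} (hx : x ∈ almostUnitary B) (k : ℕ) :
    ‖unitaryPart x - newtonSchulz^[k + 1] x‖ < ((2 : ℝ) ^ k)⁻¹ := by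
  have h1 := (almostUnitary_defect hx).1
  refine (norm_unitaryPart_sub_iterate_le h1 (k + 1)).trans_lt ?_
  have : 0 < ((2 : ℝ) ^ k)⁻¹ := by positivity
  rw [pow_succ, one_div, inv_pow]
  nlinarith

theorem almostUnitary_mem_nhds {t : B} (ht : t ∈ unitary B) : almostUnitary B ∈ 𝓝 t := by
  have h1 : ContinuousAt (fun x : B => ‖star x * x - 1‖) t := by fun_prop
  have h2 : ContinuousAt (fun x : B => ‖x * star x - 1‖) t := by fun_prop
  refine (h1.eventually_lt_const ?_).and (h2.eventually_lt_const ?_)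
  · simp [Unitary.star_mul_self_of_mem ht]
  · simp [Unitary.mul_star_self_of_mem ht]

/-- Elements close to a unitary have their unitary part close to it. -/
theorem tendsto_unitaryPart {t : B} (ht : t ∈ unitary B) : Tendsto unitaryPart (𝓝 t) (𝓝 t) := by
  refine tendsto_iff_norm_sub_tendsto_zero.2 ?_
  have hc : ContinuousAt (fun x : B => 2 * ‖1 - star x * x‖ + ‖x - t‖) t := by fun_prop
  have h0 : Tendsto (fun x : B => 2 * ‖1 - star x * x‖ + ‖x - t‖) (𝓝 t) (𝓝 0) := by
    have := hc.tendsto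
    simpa [Unitary.star_mul_self_of_mem ht] using this
  refine squeeze_zero' (Eventually.of_forall fun _ => norm_nonneg _) ?_ h0
  filter_upwards [almostUnitary_mem_nhds ht] with x hx
  have h := norm_unitaryPart_sub_iterate_le (almostUnitary_defect hx).1 0
  rw [pow_zero, mul_one, Function.iterate_zero_apply] at h
  calc ‖unitaryPart x - t‖ = ‖(unitaryPart x - x) + (x - t)‖ := by rw [sub_add_sub_cancel]
    _ ≤ _ := (norm_add_le _ _).trans (by gcongr)

end NewtonSchulz

/-! ### Computable families of elements and semidecidable properties -/

section SemiDecidable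

variable {α β σ : Type*} [Primcodable α] [Primcodable β] [Primcodable σ]

theorem Computable.bool_and {f g : α → Bool} (hf : Computable f) (hg : Computable g) :
    Computable fun a => f a && g a :=
  (Primrec.and.to_comp.comp hf hg :)

theorem Computable.list_all {f : α → List β} {p : α → β → Bool} (hf : Computable f)
    (hp : Computable₂ p) : Computable fun a => (f a).all (p a) := by
  have hstep : Computable₂ fun (a : α) (ib : ℕ × Bool) =>
      ib.2 && (((f a)[ib.1]?).map (p a)).getD true :=
    Computable.bool_and (Computable.snd.comp Computable.snd)
      (Computable.option_getD
        (Computable.option_map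
          (Computable.list_getElem?.comp (hf.comp Computable.fst)
            (Computable.fst.comp Computable.snd))
          (hp.comp (Computable.fst.comp Computable.fst) Computable.snd))
        (Computable.const true))
  refine (Computable.nat_rec (Computable.list_length.comp hf) (Computable.const true)
    hstep).of_eq fun a => ?_
  have key (i : ℕ) : (Nat.rec true (fun j b => b && (((f a)[j]?).map (p a)).getD true) i : Bool) =
      ((f a).take i).all (p a) := by
    induction i with
    | zero => simp
    | succ i ih =>
      change (_ && (((f a)[i]?).map (p a)).getD true) = _
      rw [ih, List.take_add_one, List.all_append]
      cases (f a)[i]? <;> simp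
  simpa using key (f a).length

/-- The property `p` is semidecidable, uniformly on the domain `S`: there is a total algorithm
which accepts `(a, k)` for all large `k` if `p a` holds, and for no `k` otherwise. Nothing is
required of the algorithm outside `S`. -/
def SemiDecidableOn (S : Set α) (p : α → Prop) : Prop :=
  ∃ t : α × ℕ → Bool, Computable t ∧ ∀ a ∈ S,
    (∀ k, t (a, k) = true → p a) ∧ (p a → ∀ᶠ k in atTop, t (a, k) = true)

theorem SemiDecidableOn.comp {S : Set α} {p : α → Prop} (hp : SemiDecidableOn S p) {T : Set β}
    {g : β → α} (hg : Computable g) (hT : ∀ b ∈ T, g b ∈ S) :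
    SemiDecidableOn T fun b => p (g b) := by
  obtain ⟨t, ht, h⟩ := hp
  exact ⟨fun x => t (g x.1, x.2), ht.comp ((hg.comp Computable.fst).pair Computable.snd),
    fun b hb => h (g b) (hT b hb)⟩

/-- A conjunction is semidecidable when the second property is so where the first one holds. -/
theorem SemiDecidableOn.and {S : Set α} {p q : α → Prop} (hp : SemiDecidableOn S p)
    (hq : SemiDecidableOn {a | a ∈ S ∧ p a} q) : SemiDecidableOn S fun a => p a ∧ q a := by
  obtain ⟨t, ht, h⟩ := hp
  obtain ⟨u, hu, h'⟩ := hq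
  refine ⟨fun x => t x && u x, Computable.bool_and ht hu, fun a ha => ⟨fun k hk => ?_, ?_⟩⟩
  · rw [Bool.and_eq_true] at hk
    have hpa := (h a ha).1 k hk.1
    exact ⟨hpa, (h' a ⟨ha, hpa⟩).1 k hk.2⟩
  · rintro ⟨hpa, hqa⟩
    filter_upwards [(h a ha).2 hpa, (h' a ⟨ha, hpa⟩).2 hqa] with k h1 h2
    simp [h1, h2]

theorem SemiDecidableOn.forall_mem_list {S : Set α} {p : α × β → Prop}
    (hp : SemiDecidableOn {x | x.1 ∈ S} p) {f : α → List β} (hf : Computable f) :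
    SemiDecidableOn S fun a => ∀ b ∈ f a, p (a, b) := by
  obtain ⟨t, ht, h⟩ := hp
  refine ⟨fun x => (f x.1).all fun b => t ((x.1, b), x.2),
    Computable.list_all (hf.comp Computable.fst) (ht.comp
      (((Computable.fst.comp Computable.fst).pair Computable.snd).pair
        (Computable.snd.comp Computable.fst))), fun a ha => ⟨fun k hk b hb => ?_, fun hall => ?_⟩⟩
  · exact (h (a, b) ha).1 k (List.all_eq_true.1 hk b hb)
  · have : ∀ᶠ k in atTop, ∀ b ∈ {b | b ∈ f a}, t ((a, b), k) = true :=
      (eventually_all_finite (f a).finite_toSet).2 fun b hb => (h (a, b) ha).2 (hall b hb)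
    filter_upwards [this] with k hk
    exact List.all_eq_true.2 hk

/-- Computable dependent choice. If the relation `R` is semidecidable on the states in `G`, each
state in `G` has a successful choice `b`, and the updated state is again in `G`, then searching
at each stage for a choice yields a computable run. -/
theorem exists_computable_run {G : Set σ} {R : ℕ × σ → β → Prop}
    (hR : SemiDecidableOn {x : (ℕ × σ) × β | x.1.2 ∈ G} fun x => R x.1 x.2)
    {upd : (ℕ × σ) × β → σ} (hupd : Computable upd)
    (hG : ∀ x b, x.2 ∈ G → R x b → upd (x, b) ∈ G)
    (hex : ∀ x : ℕ × σ, x.2 ∈ G → ∃ b, R x b) {s₀ : σ} (hs₀ : s₀ ∈ G) :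
    ∃ (s : ℕ → σ) (b : ℕ → β), Computable s ∧ Computable b ∧
      ∀ n, s n ∈ G ∧ R (n, s n) (b n) ∧ s (n + 1) = upd ((n, s n), b n) := by
  obtain ⟨t, ht, h⟩ := hR
  let F : ℕ × σ → ℕ → Option β := fun x i =>
    (Encodable.decode (α := β × ℕ) i).bind fun y => cond (t ((x, y.1), y.2)) (some y.1) none
  have hF : Computable₂ F := by
    refine Computable.option_bind (Computable.decode.comp Computable.snd) ?_
    have hy : Computable fun z : ((ℕ × σ) × ℕ) × (β × ℕ) => z.2.1 :=
      Computable.fst.comp Computable.snd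
    exact Computable.cond
      (ht.comp (((Computable.fst.comp Computable.fst).pair hy).pair
        (Computable.snd.comp Computable.snd)))
      (Computable.option_some.comp hy) (Computable.const none)
  have hFspec (x : ℕ × σ) (hx : x.2 ∈ G) (b : β) (hb : b ∈ Nat.rfindOpt (F x)) : R x b := by
    obtain ⟨i, hi⟩ := Nat.rfindOpt_spec hb
    obtain ⟨y, -, hy⟩ := Option.bind_eq_some_iff.1 hi
    cases hty : t ((x, y.1), y.2) with
    | false => simp [hty] at hy
    | true =>
      have hyb : y.1 = b := by simpa [hty] using hy
      exact hyb ▸ (h (x, y.1) hx).1 _ hty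
  have hFdom (x : ℕ × σ) (hx : x.2 ∈ G) : ∃ b, b ∈ Nat.rfindOpt (F x) := by
    obtain ⟨b, hb⟩ := hex x hx
    obtain ⟨k, hk⟩ := ((h (x, b) hx).2 hb).exists
    exact Part.dom_iff_mem.1 (Nat.rfindOpt_dom.2
      ⟨Encodable.encode (b, k), b, by simp [F, Encodable.encodek, hk]⟩)
  let S : ℕ →. σ := fun n => Nat.rec (Part.some s₀) (fun m IH => IH.bind fun s =>
    (Nat.rfindOpt (F (m, s))).map fun b => upd ((m, s), b)) n
  have hS : Partrec S := by
    have hstep : Partrec₂ fun (_ : ℕ) (x : ℕ × σ) =>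
        (Nat.rfindOpt (F x)).map fun b => upd (x, b) :=
      ((Partrec.rfindOpt hF).comp Computable.snd).map
        (hupd.comp ((Computable.snd.comp Computable.fst).pair Computable.snd))
    exact Partrec.nat_rec Computable.id (Computable.const s₀).partrec hstep
  have hSG (n : ℕ) : ∃ s, s ∈ S n ∧ s ∈ G := by
    induction n with
    | zero => exact ⟨s₀, Part.mem_some _, hs₀⟩
    | succ n ih =>
      obtain ⟨s, hs, hsG⟩ := ih
      obtain ⟨b, hb⟩ := hFdom (n, s) hsG
      exact ⟨upd ((n, s), b), Part.mem_bind hs (Part.mem_map _ hb),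
        hG _ _ hsG (hFspec _ hsG _ hb)⟩
  choose s hs hsG using hSG
  choose b hb using fun n => hFdom (n, s n) (hsG n)
  have hsc : Computable s := hS.of_eq_tot hs
  refine ⟨s, b, hsc, ((Partrec.rfindOpt hF).comp (Computable.id.pair hsc)).of_eq_tot hb,
    fun n => ⟨hsG n, hFspec _ (hsG n) _ (hb n), ?_⟩⟩
  exact Part.mem_unique (hs (n + 1)) (Part.mem_bind (hs n) (Part.mem_map _ (hb n)))

end SemiDecidable

namespace Presentation

variable {B : Type*} [CStarAlgebra B] {Q : Presentation B}
variable {α β : Type*} [Primcodable α] [Primcodable β]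

/-- The elements `X a`, for `a` in the domain `S`, are computable points of `Q` uniformly in `a`.
The algorithm is total, but nothing is required of it outside `S`. -/
def ComputableOn (Q : Presentation B) (S : Set α) (X : α → B) : Prop :=
  ∃ f : α × ℕ → RatPoly, Computable f ∧
    ∀ a ∈ S, ∀ k : ℕ, ‖X a - Q.point (f (a, k))‖ < ((2 : ℝ) ^ k)⁻¹

theorem ComputableOn.comp {S : Set α} {X : α → B} (hX : Q.ComputableOn S X) {T : Set β}
    {g : β → α} (hg : Computable g) (hT : ∀ b ∈ T, g b ∈ S) :
    Q.ComputableOn T fun b => X (g b) := by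
  obtain ⟨f, hf, h⟩ := hX
  exact ⟨fun x => f (g x.1, x.2), hf.comp ((hg.comp Computable.fst).pair Computable.snd),
    fun b hb => h (g b) (hT b hb)⟩

theorem computableOn_point (S : Set α) {g : α → RatPoly} (hg : Computable g) :
    Q.ComputableOn S fun a => Q.point (g a) :=
  ⟨fun x => g x.1, hg.comp Computable.fst, fun a _ k => by simp⟩

theorem ComputableOn.star {S : Set α} {X : α → B} (hX : Q.ComputableOn S X) :
    Q.ComputableOn S fun a => star (X a) := by
  obtain ⟨f, hf, h⟩ := hX
  refine ⟨fun x => RatPoly.adj (f x), primrec_ratPoly_adj.to_comp.comp hf, fun a ha k => ?_⟩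
  rw [point_adj, ← star_sub, norm_star]
  exact h a ha k

theorem ComputableOn.sub {S : Set α} {X Y : α → B} (hX : Q.ComputableOn S X)
    (hY : Q.ComputableOn S Y) : Q.ComputableOn S fun a => X a - Y a := by
  obtain ⟨f, hf, h⟩ := hX
  obtain ⟨g, hg, h'⟩ := hY
  have hs : Computable fun x : α × ℕ => (x.1, x.2 + 1) :=
    Computable.fst.pair (Computable.succ.comp Computable.snd)
  refine ⟨fun x => f (x.1, x.2 + 1) ++ RatPoly.smul (-1, 0, 0) (g (x.1, x.2 + 1)),
    Computable.list_append.comp (hf.comp hs)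
      ((primrec_ratPoly_smul _).to_comp.comp (hg.comp hs)), fun a ha k => ?_⟩
  have hm : gaussRat (-1, 0, 0) = -1 := by simp [gaussRat]
  rw [point_append, point_smul, hm, neg_one_smul, ← sub_eq_add_neg, sub_sub_sub_comm]
  refine (norm_sub_le _ _).trans_lt ((add_lt_add (h a ha _) (h' a ha _)).trans_eq ?_)
  rw [pow_succ]
  field_simp
  norm_num

theorem IsComputable.exists_norm_le (hQ : Q.IsComputable) :
    ∃ N : RatPoly → ℕ, Computable N ∧ ∀ p, ‖Q.point p‖ ≤ N p := by
  obtain ⟨f, hf, h⟩ := hQ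
  refine ⟨fun p => (f (p, 0)).1.toNat + 1, Computable.succ.comp
    (Primrec.int_toNat.to_comp.comp (Computable.fst.comp
      (hf.comp (Computable.id.pair (Computable.const 0))))), fun p => ?_⟩
  have h1 := (abs_lt.1 (h p 0)).2
  have h2 : (codedRat (f (p, 0)) : ℝ) ≤ ((f (p, 0)).1.toNat : ℝ) := by
    simp only [codedRat]
    push_cast
    have h3 : ((f (p, 0)).1 : ℝ) ≤ ((f (p, 0)).1.toNat : ℝ) := by
      exact_mod_cast Int.self_le_toNat _
    exact (div_le_div_of_nonneg_right h3 (by positivity)).trans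
      (div_le_self (by positivity) (by simp))
  rw [pow_zero, inv_one] at h1
  push_cast
  linarith

theorem ComputableOn.mul (hQ : Q.IsComputable) {S : Set α} {X Y : α → B}
    (hX : Q.ComputableOn S X) (hY : Q.ComputableOn S Y) :
    Q.ComputableOn S fun a => X a * Y a := by
  obtain ⟨f, hf, h⟩ := hX
  obtain ⟨g, hg, h'⟩ := hY
  obtain ⟨N, hN, hNb⟩ := hQ.exists_norm_le
  -- `M a` bounds `‖X a‖ + ‖Y a‖ + 1`, and `M a < 2 ^ M a`.
  let M : α → ℕ := fun a => N (f (a, 0)) + N (g (a, 0)) + 3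
  have hM : Computable M :=
    Primrec.nat_add.to_comp.comp
      (Primrec.nat_add.to_comp.comp
        (hN.comp (hf.comp (Computable.id.pair (Computable.const 0))))
        (hN.comp (hg.comp (Computable.id.pair (Computable.const 0)))))
      (Computable.const 3)
  have hs : Computable fun x : α × ℕ => (x.1, x.2 + M x.1) :=
    Computable.fst.pair (Primrec.nat_add.to_comp.comp Computable.snd (hM.comp Computable.fst))
  refine ⟨fun x => RatPoly.mul (f (x.1, x.2 + M x.1)) (g (x.1, x.2 + M x.1)),
    primrec_ratPoly_mul.to_comp.comp (hf.comp hs) (hg.comp hs), fun a ha k => ?_⟩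
  rw [point_mul]
  have b1 : ‖X a‖ ≤ N (f (a, 0)) + 1 := by
    have := norm_le_norm_add_norm_sub' (X a) (Q.point (f (a, 0)))
    have h0 := h a ha 0
    rw [pow_zero, inv_one] at h0
    linarith [hNb (f (a, 0))]
  have b2 : ‖Y a‖ ≤ N (g (a, 0)) + 1 := by
    have := norm_le_norm_add_norm_sub' (Y a) (Q.point (g (a, 0)))
    have h0 := h' a ha 0
    rw [pow_zero, inv_one] at h0
    linarith [hNb (g (a, 0))]
  have e1 := (h a ha (k + M a)).le
  have e2 := (h' a ha (k + M a)).le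
  have hsmall : ((2 : ℝ) ^ (k + M a))⁻¹ ≤ 1 := inv_le_one_of_one_le₀ (one_le_pow₀ one_le_two)
  set x' := Q.point (f (a, k + M a))
  set y' := Q.point (g (a, k + M a))
  have b3 : ‖y'‖ ≤ N (g (a, 0)) + 2 := by
    have := norm_le_norm_add_norm_sub (Y a) y'
    linarith
  have hMa : (M a : ℝ) = N (f (a, 0)) + N (g (a, 0)) + 3 := by simp [M]
  calc ‖X a * Y a - x' * y'‖ = ‖X a * (Y a - y') + (X a - x') * y'‖ := by
        congr 1
        noncomm_ring
    _ ≤ ‖X a‖ * ‖Y a - y'‖ + ‖X a - x'‖ * ‖y'‖ :=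
        (norm_add_le _ _).trans (add_le_add (norm_mul_le _ _) (norm_mul_le _ _))
    _ ≤ (N (f (a, 0)) + 1) * ((2 : ℝ) ^ (k + M a))⁻¹ +
          ((2 : ℝ) ^ (k + M a))⁻¹ * (N (g (a, 0)) + 2) := by gcongr
    _ = (M a : ℝ) * ((2 : ℝ) ^ (k + M a))⁻¹ := by rw [hMa]; ring
    _ < (2 : ℝ) ^ M a * ((2 : ℝ) ^ (k + M a))⁻¹ := by
        have : (M a : ℝ) < 2 ^ M a := by exact_mod_cast Nat.lt_two_pow_self
        gcongr
    _ = ((2 : ℝ) ^ k)⁻¹ := by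
        rw [pow_add 2 k, mul_inv, mul_left_comm, mul_inv_cancel₀ (by positivity), mul_one]

theorem ComputableOn.semiDecidableOn_norm_lt (hQ : Q.IsComputable) {S : Set α} {X : α → B}
    (hX : Q.ComputableOn S X) {n : α → ℕ} (hn : Computable n) :
    SemiDecidableOn S fun a => ‖X a‖ < ((2 : ℝ) ^ n a)⁻¹ := by
  obtain ⟨f, hf, h⟩ := hX
  obtain ⟨g, hg, h'⟩ := hQ
  let c : α × ℕ → ℤ × ℕ := fun x => g (f x, x.2)
  have hc : Computable c := hg.comp (hf.pair Computable.snd)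
  have mul {u v : α × ℕ → ℕ} (hu : Computable u) (hv : Computable v) :
      Computable fun x => u x * v x := Primrec.nat_mul.to_comp.comp hu hv
  have hnum : Computable fun x => (c x).1.toNat :=
    Primrec.int_toNat.to_comp.comp (Computable.fst.comp hc)
  have hden : Computable fun x => (c x).2 + 1 := Computable.succ.comp (Computable.snd.comp hc)
  have h2k : Computable fun x : α × ℕ => 2 ^ x.2 :=
    Primrec.nat_pow_two.to_comp.comp Computable.snd
  have h2n : Computable fun x : α × ℕ => 2 ^ n x.1 :=
    Primrec.nat_pow_two.to_comp.comp (hn.comp Computable.fst)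
  -- With `ν` the computed approximation of the norm, the test is `ν + 2 / 2 ^ k ≤ 1 / 2 ^ n`
  -- with denominators cleared.
  refine ⟨fun x => decide ((c x).1.toNat * (2 ^ x.2 * 2 ^ n x.1) + 2 * (((c x).2 + 1) * 2 ^ n x.1)
      ≤ ((c x).2 + 1) * 2 ^ x.2), ?_, fun a ha => ?_⟩
  · exact (Primrec.nat_le.decide.to_comp).comp
      (Primrec.nat_add.to_comp.comp (mul hnum (mul h2k h2n))
        (mul (Computable.const 2) (mul hden h2n))) (mul hden h2k)
  have htest (k : ℕ) : ((c (a, k)).1.toNat * (2 ^ k * 2 ^ n a) + 2 * (((c (a, k)).2 + 1) * 2 ^ n a)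
      ≤ ((c (a, k)).2 + 1) * 2 ^ k) ↔
      ((c (a, k)).1.toNat : ℝ) / ((c (a, k)).2 + 1) + 2 * ((2 : ℝ) ^ k)⁻¹ ≤ ((2 : ℝ) ^ n a)⁻¹ := by
    have hD : (0 : ℝ) < ((c (a, k)).2 : ℝ) + 1 := by positivity
    rw [← div_eq_mul_inv, div_add_div _ _ hD.ne' (by positivity), inv_eq_one_div,
      div_le_div_iff₀ (by positivity) (by positivity), ← Nat.cast_le (α := ℝ)]
    push_cast
    constructor <;> intro hh <;> linarith
  have happ (k : ℕ) : |‖X a‖ - ((c (a, k)).1.toNat : ℝ) / ((c (a, k)).2 + 1)|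
      < 2 * ((2 : ℝ) ^ k)⁻¹ := by
    have h1 := h a ha k
    have h2 := h' (f (a, k)) k
    have h3 := (abs_norm_sub_norm_le (X a) (Q.point (f (a, k)))).trans_lt h1
    have hD : (0 : ℝ) < ((c (a, k)).2 : ℝ) + 1 := by positivity
    have hcr : (codedRat (c (a, k)) : ℝ) = ((c (a, k)).1 : ℝ) / ((c (a, k)).2 + 1) := by
      simp [codedRat]
    change |‖Q.point (f (a, k))‖ - (codedRat (c (a, k)) : ℝ)| < _ at h2
    rw [hcr] at h2
    -- Replacing a negative approximation by `0` only improves it.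
    have h4 : |‖Q.point (f (a, k))‖ - ((c (a, k)).1.toNat : ℝ) / ((c (a, k)).2 + 1)|
        < ((2 : ℝ) ^ k)⁻¹ := by
      rcases le_total 0 (c (a, k)).1 with hz | hz
      · have : (((c (a, k)).1.toNat : ℤ) : ℝ) = ((c (a, k)).1 : ℝ) := by
          rw [Int.toNat_of_nonneg hz]
        rw [Int.cast_natCast] at this
        rwa [this]
      · rw [Int.toNat_of_nonpos hz]
        have hneg : ((c (a, k)).1 : ℝ) / ((c (a, k)).2 + 1) ≤ 0 :=
          div_nonpos_of_nonpos_of_nonneg (by exact_mod_cast hz) hD.le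
        rw [Nat.cast_zero, zero_div, sub_zero, abs_of_nonneg (norm_nonneg _)]
        linarith [(abs_lt.1 h2).2]
    rw [abs_lt] at h3 h4 ⊢
    constructor <;> linarith [h3.1, h3.2, h4.1, h4.2]
  refine ⟨fun k hk => ?_, fun hlt => ?_⟩
  · have hk' := (htest k).1 (of_decide_eq_true hk)
    linarith [(abs_lt.1 (happ k)).2]
  · have hlim : Tendsto (fun k : ℕ => ‖X a‖ + 4 * ((2 : ℝ) ^ k)⁻¹) atTop (𝓝 ‖X a‖) := by
      have := (tendsto_pow_atTop_nhds_zero_of_lt_one (by norm_num : (0 : ℝ) ≤ 2⁻¹)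
        (by norm_num)).const_mul 4
      simpa [inv_pow] using this.const_add ‖X a‖
    filter_upwards [hlim.eventually_lt_const hlt] with k hk
    refine decide_eq_true ((htest k).2 ?_)
    linarith [(abs_lt.1 (happ k)).1]

/-- The Newton–Schulz step on coded polynomials. -/
def _root_.RatPoly.newtonSchulz (p : RatPoly) : RatPoly :=
  RatPoly.smul (3, 0, 1) p ++
    RatPoly.smul (-1, 0, 1) (RatPoly.mul (RatPoly.mul p (RatPoly.adj p)) p)

theorem point_newtonSchulz (p : RatPoly) :
    Q.point (RatPoly.newtonSchulz p) = newtonSchulz (Q.point p) := by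
  have h1 : gaussRat (3, 0, 1) = 3 / 2 := by norm_num [gaussRat]
  have h2 : gaussRat (-1, 0, 1) = -1 / 2 := by norm_num [gaussRat]
  rw [RatPoly.newtonSchulz, point_append, point_smul, point_smul, point_mul, point_mul, point_adj,
    h1, h2, newtonSchulz]

theorem computableOn_unitaryPart :
    Q.ComputableOn {r : RatPoly | Q.point r ∈ almostUnitary B} fun r => unitaryPart (Q.point r) := by
  have hnewton : Primrec RatPoly.newtonSchulz :=
    Primrec.list_append.comp (primrec_ratPoly_smul _)
      ((primrec_ratPoly_smul _).comp (primrec_ratPoly_mul.comp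
        (primrec_ratPoly_mul.comp Primrec.id primrec_ratPoly_adj) Primrec.id))
  refine ⟨fun x => RatPoly.newtonSchulz^[x.2 + 1] x.1,
    (Primrec.nat_iterate (Primrec.succ.comp Primrec.snd) Primrec.fst
      (hnewton.comp Primrec.snd).to₂).to_comp, fun r hr k => ?_⟩
  have hit (n : ℕ) : Q.point (RatPoly.newtonSchulz^[n] r) = newtonSchulz^[n] (Q.point r) := by
    induction n with
    | zero => rfl
    | succ n ih => rw [Function.iterate_succ_apply', Function.iterate_succ_apply',
        point_newtonSchulz, ih]
  rw [hit]
  exact norm_unitaryPart_sub_iterate_lt hr k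

theorem IsComputablePoint.computableOn_const {x : B} (hx : Q.IsComputablePoint x) (S : Set α) :
    Q.ComputableOn S fun _ => x := by
  obtain ⟨c, hc⟩ := hx
  choose p hp hpx using hc
  have hpc : Computable p := by
    have hcode : Partrec c.eval := Partrec.nat_iff.2 (Nat.Partrec.Code.exists_code.2 ⟨c, rfl⟩)
    exact Computable.encode_iff.1 (hcode.of_eq_tot hp)
  exact ⟨fun y => p y.2, hpc.comp Computable.snd, fun _ _ k => hpx k⟩

theorem ComputableOn.isComputableSeq {x : ℕ → B} (hx : Q.ComputableOn Set.univ x) :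
    Q.IsComputableSeq x := by
  obtain ⟨f, hf, h⟩ := hx
  have hpart : Nat.Partrec fun i => Part.some (Encodable.encode (f i.unpair)) :=
    Partrec.nat_iff.1 (Computable.encode.comp (hf.comp Computable.unpair)).partrec
  obtain ⟨c, hc⟩ := Nat.Partrec.Code.exists_code.1 hpart
  refine ⟨fun n => c.curry n,
    (Nat.Partrec.Code.primrec₂_curry.comp (Primrec.const c) Primrec.id).to_comp,
    fun n k => ⟨f (n, k), ?_, h n trivial k⟩⟩
  rw [Nat.Partrec.Code.eval_curry, hc]
  change _ ∈ Part.some (Encodable.encode (f (Nat.unpair (Nat.pair n k))))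
  rw [Nat.unpair_pair]
  exact Part.mem_some _

end Presentation

/-! ### Limits of `*`-homomorphisms -/

section Limits

variable {A : Type*} [CStarAlgebra A] {B : Type*} [CStarAlgebra B]

/-- Since `*`-homomorphisms are contractive, convergence on a dense set implies convergence
everywhere. The limit is again a `*`-homomorphism. -/
theorem exists_starAlgHom_tendsto {θ : ℕ → A →⋆ₐ[ℂ] B} {D : Set A} (hD : Dense D)
    (h : ∀ a ∈ D, CauchySeq fun n => θ n a) :
    ∃ ψ : A →⋆ₐ[ℂ] B, ∀ a, Tendsto (fun n => θ n a) atTop (𝓝 (ψ a)) := by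
  have hc (a : A) : CauchySeq fun n => θ n a := by
    refine Metric.cauchySeq_iff.2 fun ε hε => ?_
    obtain ⟨d, hd, had⟩ := Metric.dense_iff.1 hD a (ε / 3) (by positivity)
    obtain ⟨N, hN⟩ := Metric.cauchySeq_iff.1 (h d had) (ε / 3) (by positivity)
    have hb (n : ℕ) : dist (θ n a) (θ n d) < ε / 3 := by
      rw [dist_eq_norm, ← map_sub]
      refine (NonUnitalStarAlgHom.norm_apply_le (θ n) _).trans_lt ?_
      rw [← dist_eq_norm, dist_comm]
      exact hd
    refine ⟨N, fun m hm n hn => ?_⟩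
    have h1 := dist_triangle4 (θ m a) (θ m d) (θ n d) (θ n a)
    have h2 := hb n
    rw [dist_comm] at h2
    linarith [hb m, hN m hm n hn]
  choose ψ hψ using fun a => cauchySeq_tendsto_of_complete (hc a)
  refine ⟨{ toFun := ψ
            map_one' := ?_, map_mul' := ?_, map_zero' := ?_, map_add' := ?_
            commutes' := ?_, map_star' := ?_ }, hψ⟩
  · exact tendsto_nhds_unique (hψ 1) (by simp)
  · exact fun a b => tendsto_nhds_unique (hψ (a * b)) (by simpa using (hψ a).mul (hψ b))
  · exact tendsto_nhds_unique (hψ 0) (by simp)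
  · exact fun a b => tendsto_nhds_unique (hψ (a + b)) (by simpa using (hψ a).add (hψ b))
  · exact fun c => tendsto_nhds_unique (hψ _) (by simp [AlgHomClass.commutes])
  · exact fun a => tendsto_nhds_unique (hψ (star a)) (by simpa [map_star] using (hψ a).star)

end Limits

/-! ### The search for approximating unitaries -/

namespace Presentation

variable {A : Type*} [CStarAlgebra A] {B : Type*} [CStarAlgebra B]
variable (P : Presentation A) (Q : Presentation B) (φ : A →⋆ₐ[ℂ] B)

/-- The `*`-homomorphism `φ`, on the rational point with code `p`, conjugated by the unitary part
of the rational point with code `r`. -/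
noncomputable def conjPoint (r p : RatPoly) : B :=
  unitaryPart (Q.point r) * φ (P.point p) * star (unitaryPart (Q.point r))

/-- An enumeration of all coded polynomials. -/
def enumPoly (n : ℕ) : RatPoly := (Encodable.decode n).getD []

/-- The requirement on the choice `(r', c)` made at stage `n` in the state `(r, F)`, where the
current unitary is the unitary part of `r` and `F` lists the points of `A` to be kept under
control: the new unitary is the unitary part of `r'`, conjugation by it agrees up to `2^{-n}` with
conjugation by the old one on `φ(F)`, and it brings `φ(c)` within `2^{-n}` of the element of `B`
under consideration. As `n` varies, that element runs infinitely often through each rational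
point of `B`. -/
def StageSpec (x : ℕ × RatPoly × List RatPoly) (y : RatPoly × RatPoly) : Prop :=
  Q.point y.1 ∈ almostUnitary B ∧
    (∀ a ∈ x.2.2, ‖P.conjPoint Q φ y.1 a - P.conjPoint Q φ x.2.1 a‖ < ((2 : ℝ) ^ x.1)⁻¹) ∧
    ‖P.conjPoint Q φ y.1 y.2 - Q.point (enumPoly x.1.unpair.1)‖ < ((2 : ℝ) ^ x.1)⁻¹

/-- The next state: the points added to the list are the `c` just chosen and the point of `A`
with number `n`. -/
def stageUpdate (z : (ℕ × RatPoly × List RatPoly) × RatPoly × RatPoly) : RatPoly × List RatPoly :=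
  (z.2.1, z.2.2 :: enumPoly z.1.1 :: z.1.2.2)

theorem computable_enumPoly : Computable enumPoly :=
  Computable.option_getD Computable.decode (Computable.const [])

theorem enumPoly_encode (p : RatPoly) : enumPoly (Encodable.encode p) = p := by
  rw [enumPoly, Encodable.encodek, Option.getD_some]

theorem computable_stageUpdate : Computable stageUpdate :=
  (Computable.fst.comp Computable.snd).pair
    (Computable.list_cons.comp (Computable.snd.comp Computable.snd)
      (Computable.list_cons.comp (computable_enumPoly.comp (Computable.fst.comp Computable.fst))
        (Computable.snd.comp (Computable.snd.comp Computable.fst))))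

variable {P Q φ}

theorem computableOn_conjPoint (hQ : Q.IsComputable) (hφ : IsComputableMap P Q φ) :
    Q.ComputableOn {z : RatPoly × RatPoly | Q.point z.1 ∈ almostUnitary B}
      fun z => P.conjPoint Q φ z.1 z.2 := by
  have hu : Q.ComputableOn {z : RatPoly × RatPoly | Q.point z.1 ∈ almostUnitary B}
      fun z => unitaryPart (Q.point z.1) :=
    computableOn_unitaryPart.comp Computable.fst fun _ hz => hz
  have hφ' : Q.ComputableOn (Set.univ : Set RatPoly) fun p => φ (P.point p) := by
    obtain ⟨f, hf, h⟩ := hφ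
    exact ⟨f, hf, fun p _ => h p⟩
  exact (hu.mul hQ (hφ'.comp Computable.snd fun _ _ => trivial)).mul hQ hu.star

theorem semiDecidableOn_mem_almostUnitary (hQ : Q.IsComputable) (h_one : Q.IsComputablePoint 1) :
    SemiDecidableOn Set.univ fun r : RatPoly => Q.point r ∈ almostUnitary B := by
  have hr := Q.computableOn_point (Set.univ : Set RatPoly) Computable.id
  have h1 := h_one.computableOn_const (Set.univ : Set RatPoly)
  have h2 := ((hr.star.mul hQ hr).sub h1).semiDecidableOn_norm_lt hQ (Computable.const 1)
  have h3 := ((hr.mul hQ hr.star).sub h1).semiDecidableOn_norm_lt hQ (Computable.const 1)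
  have h4 := h2.and (h3.comp Computable.id fun _ _ => trivial)
  simpa only [almostUnitary, Set.mem_ofPred_eq, pow_one, id] using h4

theorem semiDecidableOn_stageSpec (hQ : Q.IsComputable) (h_one : Q.IsComputablePoint 1)
    (hφ : IsComputableMap P Q φ) :
    SemiDecidableOn {z : (ℕ × RatPoly × List RatPoly) × RatPoly × RatPoly |
      Q.point z.1.2.1 ∈ almostUnitary B} fun z => P.StageSpec Q φ z.1 z.2 := by
  have hconj := computableOn_conjPoint hQ hφ
  have hr' : Computable fun z : (ℕ × RatPoly × List RatPoly) × RatPoly × RatPoly => z.2.1 :=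
    Computable.fst.comp Computable.snd
  have hn : Computable fun z : (ℕ × RatPoly × List RatPoly) × RatPoly × RatPoly => z.1.1 :=
    Computable.fst.comp Computable.fst
  have hr : Computable fun z : (ℕ × RatPoly × List RatPoly) × RatPoly × RatPoly => z.1.2.1 :=
    Computable.fst.comp (Computable.snd.comp Computable.fst)
  have h1 : SemiDecidableOn {z : (ℕ × RatPoly × List RatPoly) × RatPoly × RatPoly |
      Q.point z.1.2.1 ∈ almostUnitary B} fun z => Q.point z.2.1 ∈ almostUnitary B :=
    (semiDecidableOn_mem_almostUnitary hQ h_one).comp hr' fun _ _ => trivial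
  have h2 : SemiDecidableOn {z : (ℕ × RatPoly × List RatPoly) × RatPoly × RatPoly |
      z ∈ {z : (ℕ × RatPoly × List RatPoly) × RatPoly × RatPoly |
        Q.point z.1.2.1 ∈ almostUnitary B} ∧ Q.point z.2.1 ∈ almostUnitary B}
      fun z => ∀ a ∈ z.1.2.2, ‖P.conjPoint Q φ z.2.1 a - P.conjPoint Q φ z.1.2.1 a‖
        < ((2 : ℝ) ^ z.1.1)⁻¹ := by
    have hX := hconj.comp (T := {w : ((ℕ × RatPoly × List RatPoly) × RatPoly × RatPoly) × RatPoly |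
      Q.point w.1.1.2.1 ∈ almostUnitary B ∧ Q.point w.1.2.1 ∈ almostUnitary B})
      (g := fun w => (w.1.2.1, w.2)) ((hr'.comp Computable.fst).pair Computable.snd)
      fun w hw => hw.2
    have hY := hconj.comp (T := {w : ((ℕ × RatPoly × List RatPoly) × RatPoly × RatPoly) × RatPoly |
      Q.point w.1.1.2.1 ∈ almostUnitary B ∧ Q.point w.1.2.1 ∈ almostUnitary B})
      (g := fun w => (w.1.1.2.1, w.2)) ((hr.comp Computable.fst).pair Computable.snd)
      fun w hw => hw.1
    have hXY := (hX.sub hY).semiDecidableOn_norm_lt hQ (n := fun w => w.1.1.1)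
      (hn.comp Computable.fst)
    exact SemiDecidableOn.forall_mem_list
      (S := {z : (ℕ × RatPoly × List RatPoly) × RatPoly × RatPoly |
        Q.point z.1.2.1 ∈ almostUnitary B ∧ Q.point z.2.1 ∈ almostUnitary B}) hXY
      (Computable.snd.comp (Computable.snd.comp Computable.fst))
  have h3 : SemiDecidableOn {z : (ℕ × RatPoly × List RatPoly) × RatPoly × RatPoly |
      Q.point z.2.1 ∈ almostUnitary B}
      fun z => ‖P.conjPoint Q φ z.2.1 z.2.2 - Q.point (enumPoly z.1.1.unpair.1)‖
        < ((2 : ℝ) ^ z.1.1)⁻¹ := by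
    have hX := hconj.comp (T := {z : (ℕ × RatPoly × List RatPoly) × RatPoly × RatPoly |
      Q.point z.2.1 ∈ almostUnitary B}) (g := fun z => z.2) Computable.snd fun w hw => hw
    have hY := Q.computableOn_point {z : (ℕ × RatPoly × List RatPoly) × RatPoly × RatPoly |
      Q.point z.2.1 ∈ almostUnitary B}
      (computable_enumPoly.comp (Computable.fst.comp (Computable.unpair.comp hn)))
    exact (hX.sub hY).semiDecidableOn_norm_lt hQ hn
  exact h1.and (h2.and (h3.comp Computable.id fun z hz => hz.1.2))

/-- If `u` is the current unitary, then `u w_N` satisfies the requirement for large `N`, and so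
does every rational point close enough to it. -/
theorem exists_stageSpec
    (hw : ∃ w : ℕ → B, (∀ n : ℕ, w n ∈ unitary B) ∧
      (∀ a : A, Tendsto (fun n => ‖w n * φ a - φ a * w n‖) atTop (𝓝 0)) ∧
      (∀ b : B, Tendsto (fun n => Metric.infDist (star (w n) * b * w n) (Set.range φ))
        atTop (𝓝 0)))
    (x : ℕ × RatPoly × List RatPoly) (hx : Q.point x.2.1 ∈ almostUnitary B) :
    ∃ y, P.StageSpec Q φ x y := by
  obtain ⟨w, hwu, hw1, hw2⟩ := hw
  obtain ⟨n, r, F⟩ := x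
  have hu := unitaryPart_mem_unitary hx
  simp only [StageSpec, conjPoint]
  set u := unitaryPart (Q.point r)
  set b := Q.point (enumPoly n.unpair.1)
  have hε : 0 < ((2 : ℝ) ^ n)⁻¹ := by positivity
  have ev1 : ∀ᶠ N in atTop, ∀ a ∈ {a | a ∈ F},
      ‖w N * φ (P.point a) - φ (P.point a) * w N‖ < ((2 : ℝ) ^ n)⁻¹ :=
    (eventually_all_finite F.finite_toSet).2 fun a _ =>
      (hw1 (P.point a)).eventually_lt_const hε
  obtain ⟨N, hN1, hN2⟩ :=
    (ev1.and ((hw2 (star u * b * u)).eventually_lt_const hε)).exists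
  have ht : u * w N ∈ unitary B := mul_mem hu (hwu N)
  set t := u * w N with htdef
  have htF (a : RatPoly) (ha : a ∈ F) :
      ‖t * φ (P.point a) * star t - u * φ (P.point a) * star u‖ < ((2 : ℝ) ^ n)⁻¹ := by
    have e : t * φ (P.point a) * star t - u * φ (P.point a) * star u =
        u * ((w N * φ (P.point a) - φ (P.point a) * w N) * star (w N)) * star u := by
      rw [sub_mul, mul_assoc (φ (P.point a)), Unitary.mul_star_self_of_mem (hwu N), htdef, star_mul]
      noncomm_ring
    rw [e, CStarRing.norm_mul_mem_unitary _ (Unitary.star_mem hu),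
      CStarRing.norm_mem_unitary_mul _ hu,
      CStarRing.norm_mul_mem_unitary _ (Unitary.star_mem (hwu N))]
    exact hN1 a ha
  obtain ⟨c, hc⟩ : ∃ c, ‖t * φ (P.point c) * star t - b‖ < ((2 : ℝ) ^ n)⁻¹ := by
    obtain ⟨_, ⟨a, rfl⟩, ha⟩ := (Metric.infDist_lt_iff (Set.range_nonempty φ)).1 hN2
    have hcont : Continuous φ :=
      AddMonoidHomClass.continuous_of_bound φ 1 fun a => by
        simpa using NonUnitalStarAlgHom.norm_apply_le φ a
    have hopen : IsOpen {a' : A | ‖φ a' - star t * b * t‖ < ((2 : ℝ) ^ n)⁻¹} :=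
      isOpen_lt (by fun_prop) continuous_const
    have hmem : a ∈ {a' : A | ‖φ a' - star t * b * t‖ < ((2 : ℝ) ^ n)⁻¹} := by
      rw [dist_comm, dist_eq_norm] at ha
      have e : star t * b * t = star (w N) * (star u * b * u) * w N := by
        rw [htdef, star_mul]
        noncomm_ring
      rw [Set.mem_ofPred_eq, e]
      exact ha
    obtain ⟨c, hc⟩ := P.denseRange_point.exists_mem_open hopen ⟨a, hmem⟩
    refine ⟨c, ?_⟩
    have e : t * φ (P.point c) * star t - b =
        t * (φ (P.point c) - star t * b * t) * star t := by
      have h1 : t * (star t * b * t) * star t = b := by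
        calc t * (star t * b * t) * star t = (t * star t) * b * (t * star t) := by noncomm_ring
          _ = b := by rw [Unitary.mul_star_self_of_mem ht, one_mul, mul_one]
      rw [mul_sub, sub_mul, h1]
    rw [e, CStarRing.norm_mul_mem_unitary _ (Unitary.star_mem ht),
      CStarRing.norm_mem_unitary_mul _ ht]
    exact hc
  have hV := tendsto_unitaryPart ht
  have ev2 : ∀ᶠ v in 𝓝 t, ∀ a ∈ {a | a ∈ F},
      ‖unitaryPart v * φ (P.point a) * star (unitaryPart v) - u * φ (P.point a) * star u‖
        < ((2 : ℝ) ^ n)⁻¹ :=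
    (eventually_all_finite F.finite_toSet).2 fun a ha =>
      ((((hV.mul_const _).mul hV.star).sub_const _).norm).eventually_lt_const (htF a ha)
  have ev3 := ((((hV.mul_const (φ (P.point c))).mul hV.star).sub_const b).norm).eventually_lt_const
    hc
  have ev0 : ∀ᶠ v in 𝓝 t, v ∈ almostUnitary B := almostUnitary_mem_nhds ht
  obtain ⟨_, ⟨r', rfl⟩, h1, h2, h3⟩ :=
    ((mem_closure_iff_frequently.1 (Q.denseRange_point t)).and_eventually
      (ev0.and (ev2.and ev3))).exists
  exact ⟨(r', c), h1, h2, h3⟩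

end Presentation

/-! ### The limit isomorphism -/

namespace Presentation

variable {A : Type*} [CStarAlgebra A] {B : Type*} [CStarAlgebra B]
variable {P : Presentation A} {Q : Presentation B} {φ : A →⋆ₐ[ℂ] B}

/-- A run of the search: `r n` is the code of a rational point whose unitary part is the `n`-th
unitary, `F n` is the list of controlled points of `A`, and `c n` is the point of `A` chosen at
stage `n`. -/
structure IsSearchRun (P : Presentation A) (Q : Presentation B) (φ : A →⋆ₐ[ℂ] B)
    (r : ℕ → RatPoly) (F : ℕ → List RatPoly) (c : ℕ → RatPoly) : Prop where
  mem_almostUnitary : ∀ n, Q.point (r n) ∈ almostUnitary B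
  list_succ : ∀ n, F (n + 1) = c n :: enumPoly n :: F n
  norm_sub_lt : ∀ n, ∀ p ∈ F n,
    ‖P.conjPoint Q φ (r (n + 1)) p - P.conjPoint Q φ (r n) p‖ < ((2 : ℝ) ^ n)⁻¹
  norm_sub_point_lt : ∀ n,
    ‖P.conjPoint Q φ (r (n + 1)) (c n) - Q.point (enumPoly n.unpair.1)‖ < ((2 : ℝ) ^ n)⁻¹

theorem exists_computable_isSearchRun (hQ : Q.IsComputable) (h_one : Q.IsComputablePoint 1)
    (hφ : IsComputableMap P Q φ)
    (hw : ∃ w : ℕ → B, (∀ n : ℕ, w n ∈ unitary B) ∧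
      (∀ a : A, Tendsto (fun n => ‖w n * φ a - φ a * w n‖) atTop (𝓝 0)) ∧
      (∀ b : B, Tendsto (fun n => Metric.infDist (star (w n) * b * w n) (Set.range φ))
        atTop (𝓝 0))) :
    ∃ r F c, IsSearchRun P Q φ r F c ∧ Computable r ∧ Computable c := by
  obtain ⟨r₀, hr₀⟩ : ∃ r₀, Q.point r₀ ∈ almostUnitary B := by
    have h1 : ∀ᶠ v in 𝓝 (1 : B), v ∈ almostUnitary B := almostUnitary_mem_nhds (one_mem _)
    obtain ⟨_, ⟨r₀, rfl⟩, h⟩ :=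
      ((mem_closure_iff_frequently.1 (Q.denseRange_point 1)).and_eventually h1).exists
    exact ⟨r₀, h⟩
  obtain ⟨s, b, hs, hb, hsb⟩ := exists_computable_run
    (G := {s : RatPoly × List RatPoly | Q.point s.1 ∈ almostUnitary B})
    (semiDecidableOn_stageSpec hQ h_one hφ) computable_stageUpdate
    (fun x y _ hy => hy.1) (fun x hx => exists_stageSpec hw x hx) (s₀ := (r₀, [])) hr₀
  have hr (n : ℕ) : (s (n + 1)).1 = (b n).1 := by rw [(hsb n).2.2]; rfl
  refine ⟨fun n => (s n).1, fun n => (s n).2, fun n => (b n).2,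
    ⟨fun n => (hsb n).1, fun n => by rw [(hsb n).2.2]; rfl, fun n p hp => ?_, fun n => ?_⟩,
    Computable.fst.comp hs, Computable.snd.comp hb⟩
  · rw [hr]
    exact (hsb n).2.1.2.1 p hp
  · rw [hr]
    exact (hsb n).2.1.2.2

namespace IsSearchRun

variable {r : ℕ → RatPoly} {F : ℕ → List RatPoly} {c : ℕ → RatPoly}

theorem mem_add (h : IsSearchRun P Q φ r F c) {n : ℕ} {p : RatPoly} (hp : p ∈ F n) (m : ℕ) :
    p ∈ F (n + m) := by
  induction m with
  | zero => exact hp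
  | succ m ih =>
    rw [← add_assoc, h.list_succ]
    simp [ih]

theorem mem_of_encode_lt (h : IsSearchRun P Q φ r F c) {p : RatPoly} {n : ℕ}
    (hn : Encodable.encode p < n) : p ∈ F n := by
  have h1 : p ∈ F (Encodable.encode p + 1) := by
    rw [h.list_succ, enumPoly_encode]
    simp
  have h2 := h.mem_add h1 (n - (Encodable.encode p + 1))
  rwa [Nat.add_sub_cancel' hn] at h2

theorem chosen_mem (h : IsSearchRun P Q φ r F c) (n : ℕ) : c n ∈ F (n + 1) := by
  rw [h.list_succ]
  simp

/-- The conjugates of `φ` along a run converge, with a controlled rate at the controlled points. -/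
theorem exists_limit (h : IsSearchRun P Q φ r F c) (hφ_inj : Function.Injective φ) :
    ∃ ψ : A →⋆ₐ[ℂ] B, Isometry ψ ∧ ∀ n, ∀ p ∈ F n,
      ‖P.conjPoint Q φ (r n) p - ψ (P.point p)‖ ≤ 2 * ((2 : ℝ) ^ n)⁻¹ := by
  let U : ℕ → unitary B := fun n => ⟨_, unitaryPart_mem_unitary (h.mem_almostUnitary n)⟩
  let θ : ℕ → A →⋆ₐ[ℂ] B := fun n =>
    ((Unitary.conjStarAlgAut ℂ B (U n) : B ≃⋆ₐ[ℂ] B) : B →⋆ₐ[ℂ] B).comp φ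
  have hθ (n : ℕ) (p : RatPoly) : θ n (P.point p) = P.conjPoint Q φ (r n) p := rfl
  have hstep (n : ℕ) (p : RatPoly) (hp : p ∈ F n) (m : ℕ) :
      dist (θ (n + m) (P.point p)) (θ (n + (m + 1)) (P.point p)) ≤
        ((2 : ℝ) ^ n)⁻¹ * (1 / 2) ^ m := by
    rw [dist_comm, dist_eq_norm, hθ, hθ]
    refine (h.norm_sub_lt (n + m) p (h.mem_add hp m)).le.trans_eq ?_
    rw [pow_add, mul_inv, one_div, inv_pow]
  obtain ⟨ψ, hψ⟩ := exists_starAlgHom_tendsto (θ := θ) P.denseRange_point (by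
    rintro _ ⟨p, rfl⟩
    have hc := cauchySeq_of_le_geometric (f := fun m => θ (Encodable.encode p + 1 + m) (P.point p))
      _ _ (by norm_num) (hstep _ p (h.mem_of_encode_lt (Nat.lt_succ_self _)))
    obtain ⟨x, hx⟩ := cauchySeq_tendsto_of_complete hc
    have hx' : Tendsto (fun m => θ (m + (Encodable.encode p + 1)) (P.point p)) atTop (𝓝 x) := by
      simpa only [add_comm] using hx
    exact ((tendsto_add_atTop_iff_nat (f := fun m => θ m (P.point p)) _).1 hx').cauchySeq)
  refine ⟨ψ, AddMonoidHomClass.isometry_of_norm ψ fun a => ?_, fun n p hp => ?_⟩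
  · have hinj (n : ℕ) : Function.Injective (θ n) :=
      (Unitary.conjStarAlgAut ℂ B (U n)).injective.comp hφ_inj
    refine tendsto_nhds_unique (hψ a).norm ?_
    simp only [NonUnitalStarAlgHom.norm_map (θ _) (hinj _)]
    exact tendsto_const_nhds
  · have ht : Tendsto (fun m => θ (n + m) (P.point p)) atTop (𝓝 (ψ (P.point p))) := by
      simpa only [add_comm] using
        (tendsto_add_atTop_iff_nat (f := fun m => θ m (P.point p)) n).2 (hψ (P.point p))
    have := dist_le_of_le_geometric_of_tendsto (1 / 2) _ (by norm_num) (hstep n p hp) ht 0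
    rw [dist_eq_norm, add_zero, hθ] at this
    refine this.trans_eq ?_
    ring

/-- The point chosen at stage `⟨q, k⟩` is mapped by the limit close to the rational point `q`. -/
theorem norm_limit_chosen_sub_le (h : IsSearchRun P Q φ r F c) {ψ : A →⋆ₐ[ℂ] B}
    (hψ : ∀ n, ∀ p ∈ F n,
      ‖P.conjPoint Q φ (r n) p - ψ (P.point p)‖ ≤ 2 * ((2 : ℝ) ^ n)⁻¹) (q : RatPoly) (k : ℕ) :
    ‖ψ (P.point (c (Nat.pair (Encodable.encode q) (k + 1)))) - Q.point q‖ < ((2 : ℝ) ^ k)⁻¹ := by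
  set n := Nat.pair (Encodable.encode q) (k + 1) with hn
  have h1 := hψ (n + 1) _ (h.chosen_mem n)
  have h2 := h.norm_sub_point_lt n
  rw [hn, Nat.unpair_pair, ← hn, enumPoly_encode] at h2
  have hkn : ((2 : ℝ) ^ n)⁻¹ ≤ ((2 : ℝ) ^ (k + 1))⁻¹ :=
    inv_anti₀ (by positivity) (pow_le_pow_right₀ one_le_two (Nat.right_le_pair _ _))
  have h3 := norm_sub_le_norm_sub_add_norm_sub (ψ (P.point (c n)))
    (P.conjPoint Q φ (r (n + 1)) (c n)) (Q.point q)
  rw [norm_sub_rev] at h1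
  rw [pow_succ, mul_inv] at h1 hkn
  linarith

end IsSearchRun

end Presentation

theorem mainTheorem1 {A : Type*} {B : Type*} [CStarAlgebra A] [CStarAlgebra B]
    [TopologicalSpace.SeparableSpace A] [TopologicalSpace.SeparableSpace B]
    (P : Presentation A) (Q : Presentation B)
    (hP : P.IsComputable) (hQ : Q.IsComputable)
    (φ : A →⋆ₐ[ℂ] B) (hφ_inj : Function.Injective φ)
    (h_one : Q.IsComputablePoint 1)
    (hφ : Presentation.IsComputableMap P Q φ)
    (hw : ∃ w : ℕ → B, (∀ n : ℕ, w n ∈ unitary B) ∧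
      (∀ a : A, Tendsto (fun n => ‖w n * φ a - φ a * w n‖) atTop (𝓝 0)) ∧
      (∀ b : B, Tendsto (fun n => Metric.infDist (star (w n) * b * w n) (Set.range φ))
        atTop (𝓝 0))) :
    ∃ ψ : A ≃⋆ₐ[ℂ] B, Presentation.IsComputableIso P Q ψ ∧
      Presentation.CompApproxUnitarilyEquiv P Q φ (ψ : A →⋆ₐ[ℂ] B) := by
  obtain ⟨r, F, c, h, hr, hc⟩ := Presentation.exists_computable_isSearchRun hQ h_one hφ hw
  obtain ⟨ψ₀, hψ_iso, hψ⟩ := h.exists_limit hφ_inj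
  have hsurj : Function.Surjective ψ₀ := by
    have hclosed : IsClosed (Set.range ψ₀) := hψ_iso.isClosedEmbedding.isClosed_range
    have hsub : Set.range Q.point ⊆ Set.range ψ₀ := by
      rintro _ ⟨q, rfl⟩
      rw [← hclosed.closure_eq]
      refine Metric.mem_closure_range_iff.2 fun ε hε => ?_
      obtain ⟨k, hk⟩ := exists_pow_lt_of_lt_one hε (by norm_num : (2⁻¹ : ℝ) < 1)
      refine ⟨P.point (c (Nat.pair (Encodable.encode q) (k + 1))), ?_⟩
      rw [dist_comm, dist_eq_norm]
      refine (h.norm_limit_chosen_sub_le hψ q k).trans ?_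
      rwa [← inv_pow]
    exact fun y => closure_minimal hsub hclosed (Q.denseRange_point y)
  let ψ : A ≃⋆ₐ[ℂ] B := StarAlgEquiv.ofBijective ψ₀ ⟨hψ_iso.injective, hsurj⟩
  have hψ_apply (a : A) : ψ a = ψ₀ a := rfl
  -- The stage from which on the `n`-th unitary implements `ψ` on the point `p` up to `2 ^ (-m)`.
  let g : RatPoly × ℕ → ℕ := fun x => Encodable.encode x.1 + (x.2 + 2)
  have hg : Computable g :=
    Primrec.nat_add.to_comp.comp (Computable.encode.comp Computable.fst)
      (Computable.succ.comp (Computable.succ.comp Computable.snd))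
  have hgψ (p : RatPoly) (m : ℕ) :
      ‖P.conjPoint Q φ (r (g (p, m))) p - ψ (P.point p)‖ < ((2 : ℝ) ^ m)⁻¹ := by
    have hle : ((2 : ℝ) ^ g (p, m))⁻¹ ≤ ((2 : ℝ) ^ (m + 2))⁻¹ :=
      inv_anti₀ (by positivity) (pow_le_pow_right₀ one_le_two (Nat.le_add_left _ _))
    have hm : 0 < ((2 : ℝ) ^ m)⁻¹ := by positivity
    refine (hψ _ p (h.mem_of_encode_lt (by simp only [g]; omega))).trans_lt ?_
    rw [pow_add 2 m 2, mul_inv] at hle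
    linarith
  have hψ_comp : Presentation.IsComputableMap P Q ψ := by
    obtain ⟨f, hf, hfc⟩ := (Presentation.computableOn_conjPoint hQ hφ).comp
      (T := (Set.univ : Set (RatPoly × ℕ))) (g := fun x => (r (g x), x.1))
      ((hr.comp hg).pair Computable.fst) fun x _ => h.mem_almostUnitary _
    have hs : Computable fun x : RatPoly × ℕ => ((x.1, x.2 + 1), x.2 + 1) :=
      (Computable.fst.pair (Computable.succ.comp Computable.snd)).pair
        (Computable.succ.comp Computable.snd)
    refine ⟨fun x => f ((x.1, x.2 + 1), x.2 + 1), hf.comp hs, fun p k => ?_⟩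
    have h1 := hgψ p (k + 1)
    have h2 := hfc (p, k + 1) trivial (k + 1)
    have h3 := norm_sub_le_norm_sub_add_norm_sub (ψ (P.point p))
      (P.conjPoint Q φ (r (g (p, k + 1))) p) (Q.point (f ((p, k + 1), k + 1)))
    rw [norm_sub_rev] at h1
    rw [pow_succ, mul_inv] at h1 h2
    linarith
  have hψ_symm_comp : Presentation.IsComputableMap Q P ψ.symm := by
    refine ⟨fun x => c (Nat.pair (Encodable.encode x.1) (x.2 + 1)), hc.comp
      (Primrec₂.natPair.to_comp.comp (Computable.encode.comp Computable.fst)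
        (Computable.succ.comp Computable.snd)), fun q k => ?_⟩
    have h1 := h.norm_limit_chosen_sub_le hψ q k
    rw [← hψ_iso.norm_map_of_map_zero (map_zero ψ₀), map_sub, ← hψ_apply, ψ.apply_symm_apply,
      norm_sub_rev]
    exact h1
  refine ⟨ψ, ⟨hψ_comp, hψ_symm_comp⟩, hφ, hψ_comp, fun n => unitaryPart (Q.point (r n)), ?_,
    fun n => unitaryPart_mem_unitary (h.mem_almostUnitary n), g, hg, hgψ⟩
  exact (Presentation.computableOn_unitaryPart.comp hr
    fun n _ => h.mem_almostUnitary n).isComputableSeq
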